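/- Let $k$ be a commutative ring and let $\mathcal{A}=(A=\bigoplus_{i\in\mathbb{Z}}A^i,d)$ be a differential graded (associative, unital) $k$-algebra such that $A^i=0$ for $i<0$, the ring $A^0$ is semisimple, and $d(A^0)=0$. Let $\mathrm{dgMod}(\mathcal{A})$ be the category of dg right $\mathcal{A}$-modules, with morphisms the $A$-linear maps of degree $0$ that commute with the differentials. For $l\in\mathbb{Z}$ the shift $\{l\}M$ of a dg module $M$ is given by $(\{l\}M)^i=M^{i+l}$ and $d_{\{l\}M}=(-1)^l d_M$. For a simple right $A^0$-module $L$, let $\hat L=L\otimes_{A^0}A$ be the dg module with $\hat L^i=L\otimes_{A^0}A^i$ and differential $\mathrm{id}_L\otimes d$. Let $\mathrm{dgFilt}(\mathcal{A})$ be the class of dg modules $M$ that admit a finite filtration $0=F_0(M)\subset F_1(M)\subset\dots\subset F_n(M)=M$ by dg submodules with $F_i(M)/F_{i-1}(M)\cong\{l_i\}\hat L_i$ in $\mathrm{dgMod}(\mathcal{A})$ for suitable simple right $A^0$-modules $L_i$ and integers $l_1\geq l_2\geq\dots\geq l_n$. Proposition (Fitting decomposition). Let $M$ be in $\mathrm{dgFilt}(\mathcal{A})$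 and let $f:M\to M$ be an endomorphism in $\mathrm{dgMod}(\mathcal{A})$. Then there is an $N\in\mathbb{N}$ such that for all $n\geq N$ $$\ker f^n=\ker f^{n+1},\qquad \operatorname{im} f^n=\operatorname{im} f^{n+1},\qquad M=\ker f^n\oplus\operatorname{im} f^n,$$ the last being a direct sum decomposition of dg modules. -/

import Mathlib

open scoped TensorProduct

universe uk u w w₁ w₂ w₃

/-- A differential on a `ℤ`-graded associative unital `k`-algebra `A = ⨁ 𝒜 i`, making it a
dg algebra: a `k`-linear map of degree `1` with square zero and the graded Leibniz rule
`d (a b) = (d a) b + (-1)^{|a|} a (d b)`. -/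
structure DGAlgebra {k : Type uk} [CommRing k] {A : Type u} [Ring A] [Algebra k A]
    (𝒜 : ℤ → Submodule k A) [GradedAlgebra 𝒜] where
  d : A →ₗ[k] A
  d_mem : ∀ {i : ℤ} {a : A}, a ∈ 𝒜 i → d a ∈ 𝒜 (i + 1)
  d_d : ∀ a : A, d (d a) = 0
  leibniz : ∀ {i : ℤ} {a : A}, a ∈ 𝒜 i → ∀ b : A,
    d (a * b) = d a * b + i.negOnePow • (a * d b)

namespace DGAlgebra

variable {k : Type uk} [CommRing k] {A : Type u} [Ring A] [Algebra k A]
  {𝒜 : ℤ → Submodule k A} [GradedAlgebra 𝒜]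

/-- The standing assumptions on the dg algebra: it is positively graded, its degree zero part
is a semisimple ring, and the differential vanishes on the degree zero part. -/
structure IsAdmissible (D : DGAlgebra 𝒜) : Prop where
  pos_graded : ∀ i : ℤ, i < 0 → 𝒜 i = ⊥
  semisimple : IsSemisimpleRing (𝒜 0)
  d_zero : ∀ a ∈ 𝒜 0, D.d a = 0

/-- Multiplication of homogeneous elements, `A^i × A^j → A^n` for `i + j = n`. -/
def gmul (_D : DGAlgebra 𝒜) {i j n : ℤ} (h : i + j = n) (a : 𝒜 i) (b : 𝒜 j) : 𝒜 n :=
  ⟨a.1 * b.1, h ▸ SetLike.mul_mem_graded a.2 b.2⟩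

/-- The differential on homogeneous elements, `A^i → A^j` for `i + 1 = j`. -/
def gd (D : DGAlgebra 𝒜) {i j : ℤ} (h : i + 1 = j) (a : 𝒜 i) : 𝒜 j :=
  ⟨D.d a.1, h ▸ D.d_mem a.2⟩

end DGAlgebra

/-- A dg (right) module over the dg algebra `D`, given by its homogeneous components `M^i`, the
actions `M^i × A^j → M^{i+j}` and the differentials `M^i → M^{i+1}`. The indices of the targets
are variables subject to an equation. The `k`-module structure on `M^i` is the one
induced by the action of `k → A^0`; the action and the differential are then `k`-linear. -/
structure DGModule {k : Type uk} [CommRing k] {A : Type u} [Ring A] [Algebra k A]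
    {𝒜 : ℤ → Submodule k A} [GradedAlgebra 𝒜] (D : DGAlgebra 𝒜) where
  X : ℤ → Type w
  [grp : ∀ i, AddCommGroup (X i)]
  act : ∀ {i j n : ℤ}, i + j = n → X i →+ 𝒜 j →+ X n
  act_one : ∀ {i : ℤ} (x : X i), act (add_zero i) x ⟨1, SetLike.one_mem_graded 𝒜⟩ = x
  act_act : ∀ {i j l p q n : ℤ} (h₁ : i + j = p) (h₂ : p + l = n) (h₃ : j + l = q)
    (h₄ : i + q = n) (x : X i) (a : 𝒜 j) (b : 𝒜 l),
    act h₂ (act h₁ x a) b = act h₄ x (D.gmul h₃ a b)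
  d : ∀ {i j : ℤ}, i + 1 = j → X i →+ X j
  d_d : ∀ {i j l : ℤ} (h₁ : i + 1 = j) (h₂ : j + 1 = l) (x : X i), d h₂ (d h₁ x) = 0
  leibniz : ∀ {i j n i' j' n' : ℤ} (h : i + j = n) (hi : i + 1 = i') (hj : j + 1 = j')
    (hn : n + 1 = n') (h₁ : i' + j = n') (h₂ : i + j' = n') (x : X i) (a : 𝒜 j),
    d hn (act h x a) = act h₁ (d hi x) a + i.negOnePow • act h₂ x (D.gd hj a)

namespace DGModule

attribute [instance] DGModule.grp

variable {k : Type uk} [CommRing k] {A : Type u} [Ring A] [Algebra k A]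
  {𝒜 : ℤ → Submodule k A} [GradedAlgebra 𝒜] {D : DGAlgebra 𝒜}

/-- Morphisms in the category of dg modules: maps of degree `0` that commute with the action
and the differential. -/
@[ext]
structure Hom (M : DGModule.{uk, u, w₁} D) (N : DGModule.{uk, u, w₂} D) where
  toFun : ∀ i, M.X i →+ N.X i
  map_act : ∀ {i j n : ℤ} (h : i + j = n) (x : M.X i) (a : 𝒜 j),
    toFun n (M.act h x a) = N.act h (toFun i x) a
  map_d : ∀ {i j : ℤ} (h : i + 1 = j) (x : M.X i), toFun j (M.d h x) = N.d h (toFun i x)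

/-- The identity morphism. -/
def Hom.id (M : DGModule.{uk, u, w} D) : Hom M M where
  toFun i := AddMonoidHom.id (M.X i)
  map_act _ _ _ := rfl
  map_d _ _ := rfl

/-- Composition of morphisms, `g ∘ f`. -/
def Hom.comp {M : DGModule.{uk, u, w₁} D} {N : DGModule.{uk, u, w₂} D}
    {P : DGModule.{uk, u, w₃} D} (g : Hom N P) (f : Hom M N) : Hom M P where
  toFun i := (g.toFun i).comp (f.toFun i)
  map_act h x a := by simp [f.map_act, g.map_act]
  map_d h x := by simp [f.map_d, g.map_d]

/-- Endomorphisms of a dg module form a monoid under composition; this gives meaning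
to the powers `f ^ n`. -/
instance (M : DGModule.{uk, u, w} D) : Monoid (Hom M M) where
  one := Hom.id M
  mul g f := g.comp f
  mul_assoc _ _ _ := rfl
  one_mul _ := rfl
  mul_one _ := rfl

/-- Isomorphisms of dg modules (possibly in different universes). -/
structure Iso (M : DGModule.{uk, u, w₁} D) (N : DGModule.{uk, u, w₂} D) where
  hom : Hom M N
  inv : Hom N M
  hom_inv_id : inv.comp hom = Hom.id M
  inv_hom_id : hom.comp inv = Hom.id N

/-- The shift `{l} M`, with `({l} M)^i = M^{i+l}` and differential `(-1)^l d`. -/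
def shift (l : ℤ) (M : DGModule.{uk, u, w} D) : DGModule.{uk, u, w} D where
  X i := M.X (i + l)
  act {i j n} h := M.act (i := i + l) (j := j) (n := n + l) (by omega)
  act_one {i} x := by
    have key : ∀ {n : ℤ} (h : i + l + 0 = n) (h' : n = i + l),
        M.act h x ⟨1, SetLike.one_mem_graded 𝒜⟩ = h' ▸ x := by
      intro n h h'
      subst h'
      exact M.act_one x
    exact key _ rfl
  act_act _ _ h₃ _ x a b := M.act_act _ _ h₃ _ x a b
  d {i j} h := l.negOnePow • M.d (i := i + l) (j := j + l) (by omega)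
  d_d h₁ h₂ x := by
    simp only [AddMonoidHom.smul_apply, Units.smul_def, map_zsmul, M.d_d, smul_zero]
  leibniz {i j n i' j' n'} h hi hj hn h₁ h₂ x a := by
    have hs : l.negOnePow * (i + l).negOnePow = i.negOnePow := by
      rw [Int.negOnePow_add, mul_comm, mul_assoc, Int.units_mul_self, mul_one]
    simp only [AddMonoidHom.smul_apply]
    rw [M.leibniz (i := i + l) (j := j) (n := n + l) (i' := i' + l) (j' := j') (n' := n' + l)
      (by omega) (by omega) hj (by omega) (by omega) (by omega) x a,
      smul_add, smul_smul, hs]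
    congr 1
    simp only [Units.smul_def, map_zsmul, AddMonoidHom.smul_apply]

/-- A dg submodule: subgroups `U^i ⊆ M^i` stable under the action and the differential. -/
@[ext]
structure Sub (M : DGModule.{uk, u, w} D) where
  carrier : ∀ i, AddSubgroup (M.X i)
  act_mem : ∀ {i j n : ℤ} (h : i + j = n) {x : M.X i} (a : 𝒜 j),
    x ∈ carrier i → M.act h x a ∈ carrier n
  d_mem : ∀ {i j : ℤ} (h : i + 1 = j) {x : M.X i}, x ∈ carrier i → M.d h x ∈ carrier j

namespace Sub

/-- Inclusion of dg submodules. -/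
instance (M : DGModule.{uk, u, w} D) : PartialOrder (Sub M) :=
  PartialOrder.lift Sub.carrier (fun _ _ h => Sub.ext h)

/-- The zero submodule and the whole module. -/
instance (M : DGModule.{uk, u, w} D) : BoundedOrder (Sub M) where
  bot := { carrier := fun _ => ⊥
           act_mem := by
             intro i j n h x a hx
             rw [AddSubgroup.mem_bot] at hx ⊢
             simp [hx]
           d_mem := by
             intro i j h x hx
             rw [AddSubgroup.mem_bot] at hx ⊢
             simp [hx] }
  bot_le U := fun i => (bot_le : ⊥ ≤ U.carrier i)
  top := { carrier := fun _ => ⊤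
           act_mem := fun _ _ _ _ => AddSubgroup.mem_top _
           d_mem := fun _ _ _ => AddSubgroup.mem_top _ }
  le_top U := fun i => (le_top : U.carrier i ≤ ⊤)

/-- `M = U ⊕ V` (internal direct sum of dg submodules): in each degree, `M^i = U^i ⊕ V^i`. -/
def IsDirectSum {M : DGModule.{uk, u, w} D} (U V : Sub M) : Prop :=
  ∀ i, IsCompl (U.carrier i) (V.carrier i)

/-- A dg submodule, viewed as a dg module. -/
def toDGModule {M : DGModule.{uk, u, w} D} (U : Sub M) : DGModule.{uk, u, w} D where
  X i := U.carrier i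
  act {i j n} h := AddMonoidHom.mk' (fun x => AddMonoidHom.mk'
      (fun a => (⟨M.act h x.1 a, U.act_mem h a x.2⟩ : U.carrier n))
      (fun a b => Subtype.ext (by simp)))
    (fun x y => AddMonoidHom.ext fun a => Subtype.ext (by simp))
  act_one x := Subtype.ext (M.act_one x.1)
  act_act h₁ h₂ h₃ h₄ x a b := Subtype.ext (M.act_act h₁ h₂ h₃ h₄ x.1 a b)
  d {i j} h := AddMonoidHom.mk'
    (fun x => (⟨M.d h x.1, U.d_mem h x.2⟩ : U.carrier j)) (fun x y => Subtype.ext (by simp))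
  d_d h₁ h₂ x := Subtype.ext (M.d_d h₁ h₂ x.1)
  leibniz h hi hj hn h₁ h₂ x a := Subtype.ext (by
    simpa [Units.smul_def] using M.leibniz h hi hj hn h₁ h₂ x.1 a)

/-- The quotient dg module `M / U`. -/
def quotient {M : DGModule.{uk, u, w} D} (U : Sub M) : DGModule.{uk, u, w} D where
  X i := M.X i ⧸ U.carrier i
  act {i j n} h := QuotientAddGroup.lift (U.carrier i)
    (AddMonoidHom.mk' (fun x => (QuotientAddGroup.mk' (U.carrier n)).comp (M.act h x))
      (fun x y => AddMonoidHom.ext fun a => by simp))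
    (fun x hx => AddMonoidHom.ext fun a =>
      (QuotientAddGroup.eq_zero_iff _).2 (U.act_mem h a hx))
  act_one x := by
    induction x using QuotientAddGroup.induction_on with
    | H x => exact congrArg (QuotientAddGroup.mk' _) (M.act_one x)
  act_act h₁ h₂ h₃ h₄ x a b := by
    induction x using QuotientAddGroup.induction_on with
    | H x => exact congrArg (QuotientAddGroup.mk' _) (M.act_act h₁ h₂ h₃ h₄ x a b)
  d {i j} h := QuotientAddGroup.map (U.carrier i) (U.carrier j) (M.d h)
    (fun _ hx => U.d_mem h hx)
  d_d h₁ h₂ x := by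
    induction x using QuotientAddGroup.induction_on with
    | H x => exact congrArg (QuotientAddGroup.mk' _) (M.d_d h₁ h₂ x)
  leibniz h hi hj hn h₁ h₂ x a := by
    induction x using QuotientAddGroup.induction_on with
    | H x => exact congrArg (QuotientAddGroup.mk' _) (M.leibniz h hi hj hn h₁ h₂ x a)

/-- For dg submodules `U, V` of `M`, the dg submodule `U ∩ V` of the dg module `V`. -/
def restrict {M : DGModule.{uk, u, w} D} (U V : Sub M) : Sub V.toDGModule where
  carrier i := (U.carrier i).addSubgroupOf (V.carrier i)
  act_mem h _ a hx := U.act_mem h a hx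
  d_mem h _ hx := U.d_mem h hx

/-- The subquotient `V / U` for dg submodules `U ⊆ V` of `M`. -/
def subquotient {M : DGModule.{uk, u, w} D} (U V : Sub M) : DGModule.{uk, u, w} D :=
  (U.restrict V).quotient

end Sub

/-- The kernel of a morphism of dg modules. -/
def Hom.ker {M : DGModule.{uk, u, w₁} D} {N : DGModule.{uk, u, w₂} D} (f : Hom M N) :
    Sub M where
  carrier i := (f.toFun i).ker
  act_mem := by
    intro i j n h x a hx
    rw [AddMonoidHom.mem_ker] at hx ⊢
    rw [f.map_act, hx]
    simp
  d_mem := by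
    intro i j h x hx
    rw [AddMonoidHom.mem_ker] at hx ⊢
    rw [f.map_d, hx, map_zero]

/-- The image of a morphism of dg modules. -/
def Hom.im {M : DGModule.{uk, u, w₁} D} {N : DGModule.{uk, u, w₂} D} (f : Hom M N) :
    Sub N where
  carrier i := (f.toFun i).range
  act_mem := by
    rintro i j n h _ a ⟨x, rfl⟩
    exact ⟨M.act h x a, f.map_act h x a⟩
  d_mem := by
    rintro i j h _ ⟨x, rfl⟩
    exact ⟨M.d h x, f.map_d h x⟩

section Hat

variable (D) (L : Type u) [AddCommGroup L] [Module (𝒜 0)ᵐᵒᵖ L]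

/-- The relations `(l r) ⊗ a = l ⊗ (r a)`, for `r ∈ A^0`, in `L ⊗_ℤ A^j`. -/
def hatRel (j : ℤ) : AddSubgroup (L ⊗[ℤ] 𝒜 j) :=
  AddSubgroup.closure {t | ∃ (l : L) (r : 𝒜 0) (a : 𝒜 j),
    t = (MulOpposite.op r • l) ⊗ₜ[ℤ] a - l ⊗ₜ[ℤ] D.gmul (zero_add j) r a}

/-- The group `L ⊗_{A^0} A^j`. -/
abbrev hatX (j : ℤ) : Type u := (L ⊗[ℤ] 𝒜 j) ⧸ hatRel D L j

/-- The class of the elementary tensor `l ⊗ a` in `L ⊗_{A^0} A^j`. -/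
def hatMk {j : ℤ} (l : L) (a : 𝒜 j) : hatX D L j := QuotientAddGroup.mk (l ⊗ₜ[ℤ] a)

variable {D L}

/-- An additive map `A^j → A^n` commuting with left multiplication by `A^0` induces a map
`L ⊗_{A^0} A^j → L ⊗_{A^0} A^n`. -/
def hatMap {j n : ℤ} (φ : 𝒜 j →+ 𝒜 n)
    (hφ : ∀ (r : 𝒜 0) (a : 𝒜 j),
      φ (D.gmul (zero_add j) r a) = D.gmul (zero_add n) r (φ a)) :
    hatX D L j →+ hatX D L n :=
  QuotientAddGroup.map _ _ (TensorProduct.map LinearMap.id φ.toIntLinearMap).toAddMonoidHom (by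
    rw [hatRel, AddSubgroup.closure_le]
    rintro _ ⟨l, r, a, rfl⟩
    refine AddSubgroup.subset_closure ⟨l, r, φ a, ?_⟩
    simp [hφ])

theorem hatMap_hatMk {j n : ℤ} (φ : 𝒜 j →+ 𝒜 n)
    (hφ : ∀ (r : 𝒜 0) (a : 𝒜 j),
      φ (D.gmul (zero_add j) r a) = D.gmul (zero_add n) r (φ a)) (l : L) (a : 𝒜 j) :
    hatMap φ hφ (hatMk D L l a) = hatMk D L l (φ a) := rfl

theorem hatMk_add {j : ℤ} (l : L) (a b : 𝒜 j) :
    hatMk D L l (a + b) = hatMk D L l a + hatMk D L l b := by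
  simp [hatMk, TensorProduct.tmul_add]

theorem hatMk_zsmul {j : ℤ} (l : L) (m : ℤ) (a : 𝒜 j) :
    hatMk D L l (m • a) = m • hatMk D L l a := by
  simp [hatMk, TensorProduct.tmul_smul]

theorem hat_induction {j : ℤ} {p : hatX D L j → Prop} (x : hatX D L j) (h0 : p 0)
    (hmk : ∀ l a, p (hatMk D L l a)) (hadd : ∀ x y, p x → p y → p (x + y)) : p x := by
  induction x using QuotientAddGroup.induction_on with
  | H x =>
    induction x using TensorProduct.induction_on with
    | zero => exact h0
    | tmul l a => exact hmk l a
    | add x y hx hy => exact hadd _ _ hx hy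

variable (D L)

/-- The action `(L ⊗_{A^0} A^i) × A^j → L ⊗_{A^0} A^n`, `(l ⊗ a) b = l ⊗ (a b)`. -/
def hatAct {i j n : ℤ} (h : i + j = n) : hatX D L i →+ 𝒜 j →+ hatX D L n :=
  AddMonoidHom.flip (AddMonoidHom.mk' (fun b : 𝒜 j =>
    hatMap (D := D) (L := L) (AddMonoidHom.mk' (fun a : 𝒜 i => D.gmul h a b)
      (fun a a' => Subtype.ext (add_mul _ _ _)))
      (fun r a => Subtype.ext (mul_assoc _ _ _)))
    (fun b b' => AddMonoidHom.ext fun x => by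
      induction x using hat_induction with
      | h0 => simp
      | hmk l a =>
        rw [AddMonoidHom.add_apply, hatMap_hatMk, hatMap_hatMk, hatMap_hatMk, ← hatMk_add]
        exact congrArg _ (Subtype.ext (mul_add _ _ _))
      | hadd x y hx hy => rw [map_add, hx, hy, map_add]))

theorem hatAct_hatMk {i j n : ℤ} (h : i + j = n) (l : L) (a : 𝒜 i) (b : 𝒜 j) :
    hatAct D L h (hatMk D L l a) b = hatMk D L l (D.gmul h a b) := rfl

/-- The differential `l ⊗ a ↦ l ⊗ d a`; it is well defined because `d` vanishes on `A^0`. -/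
def hatD (hD : ∀ a ∈ 𝒜 0, D.d a = 0) {i j : ℤ} (h : i + 1 = j) :
    hatX D L i →+ hatX D L j :=
  hatMap (AddMonoidHom.mk' (fun a : 𝒜 i => D.gd h a)
      (fun a a' => Subtype.ext (map_add D.d _ _)))
    (fun r a => Subtype.ext (by
      change D.d (r.1 * a.1) = r.1 * D.d a.1
      rw [D.leibniz r.2, hD _ r.2]
      simp))

theorem hatD_hatMk (hD : ∀ a ∈ 𝒜 0, D.d a = 0) {i j : ℤ} (h : i + 1 = j) (l : L) (a : 𝒜 i) :
    hatD D L hD h (hatMk D L l a) = hatMk D L l (D.gd h a) := rfl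

/-- The dg module `L ⊗_{A^0} A` for a right `A^0`-module `L`, viewed as a dg `A^0`-module
concentrated in degree zero. -/
def hat (hD : ∀ a ∈ 𝒜 0, D.d a = 0) : DGModule.{uk, u, u} D where
  X := hatX D L
  act := hatAct D L
  act_one x := by
    induction x using hat_induction with
    | h0 => simp
    | hmk l a =>
      rw [hatAct_hatMk]
      exact congrArg _ (Subtype.ext (mul_one _))
    | hadd x y hx hy => rw [map_add, AddMonoidHom.add_apply, hx, hy]
  act_act h₁ h₂ h₃ h₄ x a b := by
    induction x using hat_induction with
    | h0 => simp
    | hmk l c =>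
      rw [hatAct_hatMk, hatAct_hatMk, hatAct_hatMk]
      exact congrArg _ (Subtype.ext (mul_assoc _ _ _))
    | hadd x y hx hy => simp only [map_add, AddMonoidHom.add_apply, hx, hy]
  d := hatD D L hD
  d_d h₁ h₂ x := by
    induction x using hat_induction with
    | h0 => simp
    | hmk l c =>
      rw [hatD_hatMk, hatD_hatMk]
      have : D.gd h₂ (D.gd h₁ c) = 0 := Subtype.ext (D.d_d _)
      rw [this]
      simp [hatMk]
    | hadd x y hx hy => rw [map_add, map_add, hx, hy, add_zero]
  leibniz {i j n i' j' n'} h hi hj hn h₁ h₂ x a := by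
    induction x using hat_induction with
    | h0 => simp
    | hmk l c =>
      rw [hatAct_hatMk, hatD_hatMk, hatD_hatMk, hatAct_hatMk, hatAct_hatMk, Units.smul_def,
        ← hatMk_zsmul, ← hatMk_add]
      refine congrArg _ (Subtype.ext ?_)
      have := D.leibniz c.2 a.1
      rw [Units.smul_def] at this
      simpa [DGAlgebra.gd, DGAlgebra.gmul] using this
    | hadd x y hx hy =>
      simp only [map_add, AddMonoidHom.add_apply, hx, hy, smul_add]
      abel

end Hat

/-- `M` is an object of `dgFilt`: it has a finite filtration
`0 = F_0 ⊆ F_1 ⊆ ... ⊆ F_n = M` by dg submodules with `F_i / F_{i-1} ≅ {l_i} (L_i ⊗_{A^0} A)`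
for simple right `A^0`-modules `L_i` and integers `l_1 ≥ l_2 ≥ ... ≥ l_n`. -/
def IsFilt (hD : D.IsAdmissible) (M : DGModule.{uk, u, w} D) : Prop :=
  ∃ (n : ℕ) (F : Fin (n + 1) → Sub M) (l : Fin n → ℤ),
    F 0 = ⊥ ∧ F (Fin.last n) = ⊤ ∧ Monotone F ∧ Antitone l ∧
    ∀ i : Fin n, ∃ (L : Type u) (_ : AddCommGroup L) (_ : Module (𝒜 0)ᵐᵒᵖ L),
      IsSimpleModule (𝒜 0)ᵐᵒᵖ L ∧
      Nonempty (Iso (Sub.subquotient (F i.castSucc) (F i.succ)) (shift (l i) (hat D L hD.d_zero)))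

end DGModule

namespace DGModule

variable {k : Type uk} [CommRing k] {A : Type u} [Ring A] [Algebra k A]
  {𝒜 : ℤ → Submodule k A} [GradedAlgebra 𝒜] {D : DGAlgebra 𝒜}

/-! A factor `{l} L̂` is induced from degree `m = -l`: it equals `X^m ⊗_{A^0} A`, with `X^m` of
finite length over `A^0`. Such modules are closed under extensions with the same `m`
(`IsInduced.of_exact`), so consecutive filtration steps of equal degree merge into one block.

An endomorphism `f` need not preserve the filtration, but it preserves `F_i` wherever the degree
jumps. Indeed `F_i` is generated in degrees below those of all later factors. Since `A` vanishes in
negative degrees, `M / F_i` is zero there, so `F_i` contains every element of `M` of such a degree,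
in particular the images of its own generators.

On a block, `f` induces `φ ⊗ id_A`, with `φ` an endomorphism of a module of finite length. Fitting's
lemma for `φ` yields `γ` with `γ φ^(N+1) = φ^N = φ^(N+1) γ`. These identities survive `- ⊗ A`, so
kernels and images of powers become stationary with one exponent for all degrees
(`IsInduced.exists_stable`). Exponents of successive blocks add up (`Hom.IsStable.trans`), and
stationary kernels and images give the decomposition (`Hom.IsStable.fitting`). -/

/-! ### Powers of endomorphisms and the `A^0`-structure on components. -/

theorem Hom.pow_succ_apply {M : DGModule.{uk, u, w} D} (f : Hom M M) (n : ℕ) {i : ℤ}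
    (x : M.X i) : (f ^ (n + 1)).toFun i x = (f ^ n).toFun i (f.toFun i x) := by
  rw [pow_succ]; rfl

theorem Hom.pow_add_apply {M : DGModule.{uk, u, w} D} (f : Hom M M) (m n : ℕ) {i : ℤ}
    (x : M.X i) : (f ^ (m + n)).toFun i x = (f ^ m).toFun i ((f ^ n).toFun i x) := by
  rw [pow_add]; rfl

theorem Hom.apply_mem_of_pow {M : DGModule.{uk, u, w} D} (f : Hom M M) {U : Sub M}
    (hU : ∀ i, ∀ x ∈ U.carrier i, f.toFun i x ∈ U.carrier i) (n : ℕ) :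
    ∀ i, ∀ x ∈ U.carrier i, (f ^ n).toFun i x ∈ U.carrier i := by
  induction n with
  | zero => exact fun _ _ hx => hx
  | succ n ih =>
    intro i x hx
    rw [f.pow_succ_apply]
    exact ih i _ (hU i x hx)

/-- Each homogeneous component of a dg module is a right module over `A^0`. -/
instance componentModule (M : DGModule.{uk, u, w} D) (i : ℤ) : Module (𝒜 0)ᵐᵒᵖ (M.X i) where
  smul r x := M.act (add_zero i) x r.unop
  one_smul x := M.act_one x
  mul_smul r s x :=
    (M.act_act (add_zero i) (add_zero i) (add_zero 0) (add_zero i) x s.unop r.unop).symm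
  smul_zero r := by
    change M.act _ 0 _ = 0
    rw [map_zero, AddMonoidHom.zero_apply]
  smul_add r x y := by
    change M.act _ (x + y) _ = M.act _ x _ + M.act _ y _
    rw [map_add, AddMonoidHom.add_apply]
  add_smul r s x := map_add (M.act (add_zero i) x) r.unop s.unop
  zero_smul x := map_zero (M.act (add_zero i) x)

theorem op_smul_eq_act (M : DGModule.{uk, u, w} D) {i : ℤ} (r : (𝒜 0)ᵐᵒᵖ) (x : M.X i) :
    r • x = M.act (add_zero i) x r.unop := rfl

/-- The `A^0`-linear map induced by a morphism on a homogeneous component. -/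
def Hom.component {M : DGModule.{uk, u, w₁} D} {N : DGModule.{uk, u, w₂} D} (f : Hom M N)
    (i : ℤ) : M.X i →ₗ[(𝒜 0)ᵐᵒᵖ] N.X i where
  toFun := f.toFun i
  map_add' := map_add _
  map_smul' r x := f.map_act (add_zero i) x r.unop

theorem Hom.component_apply {M : DGModule.{uk, u, w₁} D} {N : DGModule.{uk, u, w₂} D}
    (f : Hom M N) (i : ℤ) (x : M.X i) : f.component i x = f.toFun i x := rfl

theorem Hom.component_pow {M : DGModule.{uk, u, w} D} (f : Hom M M) (i : ℤ) (n : ℕ) :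
    f.component i ^ n = (f ^ n).component i := by
  induction n with
  | zero => rfl
  | succ n ih => rw [pow_succ, ih, pow_succ]; rfl

/-! ### Dg modules induced from one degree. -/

section Multiplication

/-- The multiplication map `M^m ⊗ A^j → M^n` for `m + j = n`. -/
def mulMap (M : DGModule.{uk, u, w} D) {m j n : ℤ} (h : m + j = n) :
    M.X m ⊗[ℤ] 𝒜 j →+ M.X n :=
  TensorProduct.liftAddHom (M.act h) (fun r x a => by simp)

@[simp]
theorem mulMap_tmul (M : DGModule.{uk, u, w} D) {m j n : ℤ} (h : m + j = n) (x : M.X m)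
    (a : 𝒜 j) : M.mulMap h (x ⊗ₜ a) = M.act h x a := rfl

/-- The relations `(x r) ⊗ a = x ⊗ (r a)`, for `r ∈ A^0`, in `M^m ⊗_ℤ A^j`. -/
def tensorRel (M : DGModule.{uk, u, w} D) (m j : ℤ) : AddSubgroup (M.X m ⊗[ℤ] 𝒜 j) :=
  AddSubgroup.closure {t | ∃ (x : M.X m) (r : 𝒜 0) (a : 𝒜 j),
    t = (M.act (add_zero m) x r) ⊗ₜ[ℤ] a - x ⊗ₜ[ℤ] D.gmul (zero_add j) r a}

theorem tensorRel_sub_mem (M : DGModule.{uk, u, w} D) {m j : ℤ} (x : M.X m) (r : 𝒜 0)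
    (a : 𝒜 j) : (M.act (add_zero m) x r) ⊗ₜ[ℤ] a - x ⊗ₜ[ℤ] D.gmul (zero_add j) r a ∈
      M.tensorRel m j := AddSubgroup.subset_closure ⟨x, r, a, rfl⟩

theorem mulMap_eq_zero_of_mem_tensorRel (M : DGModule.{uk, u, w} D) {m j n : ℤ}
    (h : m + j = n) {t : M.X m ⊗[ℤ] 𝒜 j} (ht : t ∈ M.tensorRel m j) : M.mulMap h t = 0 := by
  have : M.tensorRel m j ≤ (M.mulMap h).ker := by
    rw [tensorRel, AddSubgroup.closure_le]
    rintro _ ⟨x, r, a, rfl⟩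
    change M.mulMap h _ = 0
    rw [map_sub, mulMap_tmul, mulMap_tmul, M.act_act (add_zero m) h (zero_add j) h, sub_self]
  exact this ht

/-- The map `M^m ⊗ A^j → N^m ⊗ A^j` induced by an `A^0`-linear map `M^m → N^m`. -/
def tensorMap {M : DGModule.{uk, u, w₁} D} {N : DGModule.{uk, u, w₂} D} {m : ℤ}
    (φ : M.X m →ₗ[(𝒜 0)ᵐᵒᵖ] N.X m) (j : ℤ) : M.X m ⊗[ℤ] 𝒜 j →ₗ[ℤ] N.X m ⊗[ℤ] 𝒜 j :=
  LinearMap.rTensor (𝒜 j) φ.toAddMonoidHom.toIntLinearMap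

@[simp]
theorem tensorMap_tmul {M : DGModule.{uk, u, w₁} D} {N : DGModule.{uk, u, w₂} D} {m : ℤ}
    (φ : M.X m →ₗ[(𝒜 0)ᵐᵒᵖ] N.X m) {j : ℤ} (x : M.X m) (a : 𝒜 j) :
    tensorMap φ j (x ⊗ₜ a) = φ x ⊗ₜ a := rfl

theorem tensorMap_comp {M : DGModule.{uk, u, w₁} D} {N : DGModule.{uk, u, w₂} D}
    {P : DGModule.{uk, u, w₃} D} {m : ℤ} (ψ : N.X m →ₗ[(𝒜 0)ᵐᵒᵖ] P.X m)
    (φ : M.X m →ₗ[(𝒜 0)ᵐᵒᵖ] N.X m) {j : ℤ} (t : M.X m ⊗[ℤ] 𝒜 j) :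
    tensorMap ψ j (tensorMap φ j t) = tensorMap (ψ ∘ₗ φ) j t := by
  induction t with
  | zero => simp
  | tmul x a => rfl
  | add s t hs ht => simp only [map_add, hs, ht]

theorem tensorMap_id {M : DGModule.{uk, u, w₁} D} {m j : ℤ} (t : M.X m ⊗[ℤ] 𝒜 j) :
    tensorMap (M := M) (N := M) LinearMap.id j t = t := by
  induction t with
  | zero => simp
  | tmul x a => rfl
  | add s t hs ht => simp only [map_add, hs, ht]

theorem map_tensorRel_le {M : DGModule.{uk, u, w₁} D} {N : DGModule.{uk, u, w₂} D} {m : ℤ}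
    (φ : M.X m →ₗ[(𝒜 0)ᵐᵒᵖ] N.X m) {j : ℤ} {t : M.X m ⊗[ℤ] 𝒜 j}
    (ht : t ∈ M.tensorRel m j) : tensorMap φ j t ∈ N.tensorRel m j := by
  have : M.tensorRel m j ≤ (N.tensorRel m j).comap (tensorMap φ j).toAddMonoidHom := by
    rw [tensorRel, AddSubgroup.closure_le]
    rintro _ ⟨x, r, a, rfl⟩
    rw [SetLike.mem_coe, AddSubgroup.mem_comap, LinearMap.toAddMonoidHom_coe, map_sub,
      tensorMap_tmul, tensorMap_tmul]
    have := φ.map_smul (MulOpposite.op r) x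
    rw [op_smul_eq_act, op_smul_eq_act] at this
    rw [MulOpposite.unop_op] at this
    rw [this]
    exact N.tensorRel_sub_mem _ _ _
  exact this ht

/-- Generating relations lift along a surjection. Together with right exactness over `ℤ`, this does
the work of right exactness of `- ⊗_{A^0} A^j`. -/
theorem tensorRel_le_map {M : DGModule.{uk, u, w₁} D} {N : DGModule.{uk, u, w₂} D} {m : ℤ}
    (φ : M.X m →ₗ[(𝒜 0)ᵐᵒᵖ] N.X m) (hφ : Function.Surjective φ) {j : ℤ}
    {s : N.X m ⊗[ℤ] 𝒜 j} (hs : s ∈ N.tensorRel m j) :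
    ∃ t ∈ M.tensorRel m j, tensorMap φ j t = s := by
  have : N.tensorRel m j ≤ (M.tensorRel m j).map (tensorMap φ j).toAddMonoidHom := by
    rw [tensorRel, AddSubgroup.closure_le]
    rintro _ ⟨y, r, a, rfl⟩
    obtain ⟨x, rfl⟩ := hφ y
    refine ⟨_, M.tensorRel_sub_mem x r a, ?_⟩
    rw [LinearMap.toAddMonoidHom_coe, map_sub, tensorMap_tmul, tensorMap_tmul]
    have := φ.map_smul (MulOpposite.op r) x
    rw [op_smul_eq_act, op_smul_eq_act] at this
    rw [MulOpposite.unop_op] at this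
    rw [this]
  exact this hs

/-- On products a morphism acts as `φ ⊗ id`, so on an induced module it is controlled by its
component in the generating degree. -/
theorem Hom.apply_mulMap {M : DGModule.{uk, u, w₁} D} {N : DGModule.{uk, u, w₂} D}
    (f : Hom M N) {m j n : ℤ} (h : m + j = n) (t : M.X m ⊗[ℤ] 𝒜 j) :
    f.toFun n (M.mulMap h t) = N.mulMap h (tensorMap (f.component m) j t) := by
  induction t with
  | zero => simp
  | tmul x a =>
    rw [mulMap_tmul, tensorMap_tmul, mulMap_tmul, f.map_act, f.component_apply]
  | add s t hs ht => simp only [map_add, hs, ht]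

/-- `M` is induced from its component of degree `m`, that is `M = M^m ⊗_{A^0} A`, and this
component has finite length over `A^0`. -/
structure IsInduced (M : DGModule.{uk, u, w} D) (m : ℤ) : Prop where
  surj : ∀ {j n : ℤ} (h : m + j = n), Function.Surjective (M.mulMap h)
  inj : ∀ {j n : ℤ} (h : m + j = n) (t : M.X m ⊗[ℤ] 𝒜 j),
    M.mulMap h t = 0 → t ∈ M.tensorRel m j
  noetherian : IsNoetherian (𝒜 0)ᵐᵒᵖ (M.X m)
  artinian : IsArtinian (𝒜 0)ᵐᵒᵖ (M.X m)

/-- Elements of degree `i` are sums of products with factors from `A^(i-m)`, which is zero for `i <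
m`. -/
theorem IsInduced.eq_zero {M : DGModule.{uk, u, w} D} {m : ℤ} (hM : M.IsInduced m)
    (hD : D.IsAdmissible) {i : ℤ} (hi : i < m) (x : M.X i) : x = 0 := by
  obtain ⟨t, rfl⟩ := hM.surj (j := i - m) (by omega) x
  induction t with
  | zero => simp
  | tmul x a =>
    have ha : a = 0 := Subtype.ext ((Submodule.mem_bot k).1
      (hD.pos_graded (i - m) (by omega) ▸ a.2))
    simp [ha]
  | add s t hs ht => rw [map_add, hs, ht, add_zero]

/-- Only the retraction identity `inv ∘ hom = id` enters: surjectivity, relations and finite length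
all pass to a retract. -/
theorem IsInduced.of_iso {M : DGModule.{uk, u, w₁} D} {N : DGModule.{uk, u, w₂} D} {m : ℤ}
    (hN : N.IsInduced m) (e : Iso M N) : M.IsInduced m := by
  have h₁ : ∀ i (x : M.X i), e.inv.toFun i (e.hom.toFun i x) = x := fun i x =>
    DFunLike.congr_fun (congrFun (congrArg Hom.toFun e.hom_inv_id) i) x
  have h₂ : (e.inv.component m) ∘ₗ (e.hom.component m) = LinearMap.id :=
    LinearMap.ext (h₁ m)
  have hinj : Function.Injective (e.hom.component m) := Function.LeftInverse.injective (h₁ m)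
  refine ⟨fun {j n} h x => ?_, fun {j n} h t ht => ?_, ?_, ?_⟩
  · obtain ⟨t, ht⟩ := hN.surj h (e.hom.toFun n x)
    exact ⟨_, by rw [← e.inv.apply_mulMap h t, ht, h₁]⟩
  · have := map_tensorRel_le (e.inv.component m) (hN.inj h (tensorMap (e.hom.component m) j t)
      (by rw [← e.hom.apply_mulMap, ht, map_zero]))
    rwa [tensorMap_comp, h₂, tensorMap_id] at this
  · have := hN.noetherian
    exact isNoetherian_of_injective _ hinj
  · have := hN.artinian
    exact isArtinian_of_injective _ hinj

/-- A five lemma argument comparing the tensor sequence in degree `m` with the given sequence in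
degree `n`; finite length is closed under extensions. -/
theorem IsInduced.of_exact {M' : DGModule.{uk, u, w₁} D} {M : DGModule.{uk, u, w₂} D}
    {M'' : DGModule.{uk, u, w₃} D} {m : ℤ} (h' : M'.IsInduced m) (h'' : M''.IsInduced m)
    (a : Hom M' M) (b : Hom M M'') (ha : ∀ i, Function.Injective (a.toFun i))
    (hb : ∀ i, Function.Surjective (b.toFun i))
    (hab : ∀ i, Function.Exact (a.toFun i) (b.toFun i)) : M.IsInduced m := by
  refine ⟨fun {j n} h x => ?_, fun {j n} h t ht => ?_, ?_, ?_⟩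
  · obtain ⟨t'', ht''⟩ := h''.surj h (b.toFun n x)
    obtain ⟨t, rfl⟩ : ∃ t, tensorMap (b.component m) j t = t'' :=
      LinearMap.rTensor_surjective (𝒜 j) (hb m) t''
    rw [← b.apply_mulMap, eq_comm, ← sub_eq_zero, ← map_sub] at ht''
    obtain ⟨y, hy⟩ := (hab n _).1 ht''
    obtain ⟨t', rfl⟩ := h'.surj h y
    refine ⟨tensorMap (a.component m) j t' + t, ?_⟩
    rw [map_add, ← a.apply_mulMap, hy, sub_add_cancel]
  -- Correct `t` by a relation `r` so that `t - r` dies over `M''` and hence comes from `M'`;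
  -- injectivity of `a` in degree `n` then shows that its preimage multiplies to zero.
  · obtain ⟨r, hr, hrt⟩ := tensorRel_le_map (b.component m) (hb m)
      (h''.inj h (tensorMap (b.component m) j t) (by rw [← b.apply_mulMap, ht, map_zero]))
    have hex : Function.Exact (tensorMap (a.component m) j) (tensorMap (b.component m) j) :=
      rTensor_exact (𝒜 j) (f := (a.toFun m).toIntLinearMap) (g := (b.toFun m).toIntLinearMap)
        (hab m) (hb m)
    obtain ⟨t', ht'⟩ := (hex (t - r)).1 (by rw [map_sub, hrt, sub_self])
    have h0 : M'.mulMap h t' = 0 := ha n (by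
      rw [a.apply_mulMap, ht', map_sub, ht, M.mulMap_eq_zero_of_mem_tensorRel h hr, sub_zero,
        map_zero])
    have := add_mem (map_tensorRel_le (a.component m) (h'.inj h t' h0)) hr
    rwa [ht', sub_add_cancel] at this
  · have := h'.noetherian
    have := h''.noetherian
    exact isNoetherian_of_range_eq_ker (a.component m) (b.component m)
      (LinearMap.exact_iff.1 (hab m)).symm
  · have := h'.artinian
    have := h''.artinian
    exact isArtinian_of_range_eq_ker (a.component m) (b.component m)
      (LinearMap.exact_iff.1 (hab m)).symm

theorem IsInduced.shift {M : DGModule.{uk, u, w} D} {m l : ℤ} (h : M.IsInduced (m + l)) :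
    (M.shift l).IsInduced m where
  surj {j n} hn := h.surj (j := j) (n := n + l) (by omega)
  inj {j n} hn t ht := h.inj (j := j) (n := n + l) (by omega) t ht
  noetherian := h.noetherian
  artinian := h.artinian

end Multiplication

/-! ### The modules `L̂` and their shifts are induced. -/

section Hat

variable (L : Type u) [AddCommGroup L] [Module (𝒜 0)ᵐᵒᵖ L]

theorem hatMk_op_smul {j : ℤ} (l : L) (r : 𝒜 0) (a : 𝒜 j) :
    hatMk D L (MulOpposite.op r • l) a = hatMk D L l (D.gmul (zero_add j) r a) := by
  rw [← sub_eq_zero]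
  exact (QuotientAddGroup.eq_zero_iff _).2 (AddSubgroup.subset_closure ⟨l, r, a, rfl⟩)

theorem hatMk_add_left {j : ℤ} (l l' : L) (a : 𝒜 j) :
    hatMk D L (l + l') a = hatMk D L l a + hatMk D L l' a := by
  simp [hatMk, TensorProduct.add_tmul]

variable {L}

/-- The map `L → L ⊗_{A^0} A^0`, `l ↦ l ⊗ 1`. -/
def hatUnit (hd : ∀ a ∈ 𝒜 0, D.d a = 0) : L →ₗ[(𝒜 0)ᵐᵒᵖ] (hat D L hd).X 0 where
  toFun l := hatMk D L l (1 : 𝒜 0)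
  map_add' l l' := hatMk_add_left L l l' 1
  map_smul' r l := by
    change hatMk D L (MulOpposite.op r.unop • l) (1 : 𝒜 0) = hatMk D L l (D.gmul (zero_add 0) 1 r.unop)
    rw [hatMk_op_smul]
    exact congrArg _ (Subtype.ext ((mul_one _).trans (one_mul _).symm))

theorem act_hatUnit (hd : ∀ a ∈ 𝒜 0, D.d a = 0) {j : ℤ} (h : 0 + j = j) (l : L) (a : 𝒜 j) :
    (hat D L hd).act h (hatUnit hd l) a = hatMk D L l a :=
  congrArg (hatMk D L l) (Subtype.ext (one_mul _))

theorem hatUnit_surjective (hd : ∀ a ∈ 𝒜 0, D.d a = 0) :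
    Function.Surjective (hatUnit (L := L) hd) := by
  intro x
  induction x using hat_induction with
  | h0 => exact ⟨0, map_zero _⟩
  | hmk l r =>
    refine ⟨MulOpposite.op r • l, ?_⟩
    rw [map_smul]
    exact act_hatUnit hd _ l r
  | hadd x y hx hy =>
    obtain ⟨l, rfl⟩ := hx
    obtain ⟨l', rfl⟩ := hy
    exact ⟨l + l', map_add _ _ _⟩

/-- The map `L ⊗_{A^0} A^j → (L ⊗_{A^0} A^0) ⊗_{A^0} A^j`, `l ⊗ a ↦ (l ⊗ 1) ⊗ a`. -/
def hatToTensor (hd : ∀ a ∈ 𝒜 0, D.d a = 0) (j : ℤ) :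
    hatX D L j →+ ((hat D L hd).X 0 ⊗[ℤ] 𝒜 j) ⧸ (hat D L hd).tensorRel 0 j :=
  QuotientAddGroup.map _ _
    (LinearMap.rTensor (𝒜 j) (hatUnit hd).toAddMonoidHom.toIntLinearMap).toAddMonoidHom (by
      rw [hatRel, AddSubgroup.closure_le]
      rintro _ ⟨l, r, a, rfl⟩
      rw [SetLike.mem_coe, AddSubgroup.mem_comap, LinearMap.toAddMonoidHom_coe, map_sub,
        LinearMap.rTensor_tmul, LinearMap.rTensor_tmul]
      change hatUnit hd (MulOpposite.op r • l) ⊗ₜ[ℤ] a -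
        hatUnit hd l ⊗ₜ[ℤ] D.gmul (zero_add j) r a ∈ _
      rw [map_smul]
      exact tensorRel_sub_mem _ _ _ _)

theorem hat_isInduced [IsSimpleModule (𝒜 0)ᵐᵒᵖ L] (hd : ∀ a ∈ 𝒜 0, D.d a = 0) :
    (hat D L hd).IsInduced 0 := by
  refine ⟨fun {j n} h x => ?_, fun {j n} h t ht => ?_, ?_, ?_⟩
  · obtain rfl : j = n := by omega
    induction x using hat_induction with
    | h0 => exact ⟨0, map_zero _⟩
    | hmk l a => exact ⟨hatUnit hd l ⊗ₜ a, act_hatUnit hd h l a⟩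
    | hadd x y hx hy =>
      obtain ⟨s, rfl⟩ := hx
      obtain ⟨t, rfl⟩ := hy
      exact ⟨s + t, map_add _ _ _⟩
  · obtain rfl : j = n := by omega
    -- `hatToTensor` inverts multiplication modulo the relations, so whatever multiplies to zero is
    -- a relation. For this `hatUnit` need only be surjective.
    have key : ∀ t : (hat D L hd).X 0 ⊗[ℤ] 𝒜 j,
        hatToTensor hd j ((hat D L hd).mulMap h t) = QuotientAddGroup.mk t := by
      intro t
      induction t with
      | zero => exact map_zero (hatToTensor hd j)
      | tmul x a =>
        obtain ⟨l, rfl⟩ := hatUnit_surjective hd x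
        rw [mulMap_tmul, act_hatUnit]
        rfl
      | add s t hs ht =>
        rw [map_add, QuotientAddGroup.mk_add, ← hs, ← ht]
        exact map_add (hatToTensor hd j) _ _
    rw [← QuotientAddGroup.eq_zero_iff, ← key, ht]
    exact map_zero (hatToTensor hd j)
  · exact isNoetherian_of_surjective (hatUnit (L := L) hd)
      (LinearMap.range_eq_top.2 (hatUnit_surjective hd))
  · exact isArtinian_of_surjective _ (hatUnit (L := L) hd) (hatUnit_surjective hd)

/-- Shifting by `l` lowers the generating degree by `l`; decreasing shifts therefore become
increasing generating degrees. -/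
theorem isInduced_shift_hat [IsSimpleModule (𝒜 0)ᵐᵒᵖ L] (hd : ∀ a ∈ 𝒜 0, D.d a = 0) (l : ℤ) :
    (shift l (hat D L hd)).IsInduced (-l) :=
  IsInduced.shift (by rw [neg_add_cancel]; exact hat_isInduced hd)

end Hat

end DGModule

/-! ### Fitting's lemma in finite length, transported to induced modules. -/

/-- An endomorphism of a module of finite length has a Drazin inverse. -/
theorem Module.End.exists_mul_pow_succ_eq {R V : Type*} [Ring R] [AddCommGroup V] [Module R V]
    [IsNoetherian R V] [IsArtinian R V] (φ : Module.End R V) :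
    ∃ (N : ℕ) (γ : Module.End R V), γ * φ ^ (N + 1) = φ ^ N ∧ φ ^ (N + 1) * γ = φ ^ N := by
  obtain ⟨N, hN⟩ := Filter.eventually_atTop.1
    (φ.eventually_isCompl_ker_pow_range_pow.and φ.eventually_iSup_ker_pow_eq)
  have h := (hN N le_rfl).1.symm
  have hker : LinearMap.ker (φ ^ N) = LinearMap.ker (φ ^ (N + 1)) :=
    (hN N le_rfl).2.symm.trans (hN (N + 1) N.le_succ).2
  have hmaps : ∀ x ∈ LinearMap.range (φ ^ N), φ x ∈ LinearMap.range (φ ^ N) := by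
    rintro _ ⟨x, rfl⟩
    exact ⟨φ x, by rw [← Module.End.mul_apply, ← Module.End.mul_apply, ← pow_succ, pow_succ']⟩
  -- `φ` is injective on the range of `φ ^ N`, hence bijective there by the Artinian condition. The
  -- witness `γ` projects along `ker (φ ^ N)` and then inverts this restriction.
  have hinj : Function.Injective (φ.restrict hmaps) := by
    rw [← LinearMap.ker_eq_bot, LinearMap.ker_eq_bot']
    rintro ⟨_, x, rfl⟩ hx
    have hx' : φ ((φ ^ N) x) = 0 := congrArg Subtype.val hx
    have hx'' : x ∈ LinearMap.ker (φ ^ (N + 1)) := by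
      rwa [LinearMap.mem_ker, pow_succ', Module.End.mul_apply]
    rw [← hker] at hx''
    exact Subtype.ext hx''
  let e := LinearEquiv.ofBijective _ (IsArtinian.bijective_of_injective_endomorphism _ hinj)
  refine ⟨N, (LinearMap.range (φ ^ N)).subtype ∘ₗ e.symm.toLinearMap ∘ₗ
    Submodule.projectionOnto _ _ h, LinearMap.ext fun x => ?_, LinearMap.ext fun x => ?_⟩
  · have hx : (φ ^ (N + 1)) x ∈ LinearMap.range (φ ^ N) :=
      ⟨φ x, by rw [pow_succ, Module.End.mul_apply]⟩
    have he : e ⟨(φ ^ N) x, LinearMap.mem_range_self _ x⟩ = ⟨(φ ^ (N + 1)) x, hx⟩ :=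
      Subtype.ext (LinearMap.congr_fun (pow_succ' φ N) x).symm
    change ((e.symm (Submodule.projectionOnto _ _ h ((φ ^ (N + 1)) x))) : V) = (φ ^ N) x
    rw [Submodule.projectionOnto_apply_of_mem_left h hx, ← he, LinearEquiv.symm_apply_apply]
  · let p := Submodule.projectionOnto _ _ h x
    have hp : φ (e.symm p : V) = p := congrArg Subtype.val (e.apply_symm_apply p)
    have hx : x - p ∈ LinearMap.ker (φ ^ N) := by
      have := Submodule.ker_projectionOnto h
      rw [← this, LinearMap.mem_ker, map_sub, Submodule.projectionOnto_apply_left, sub_self]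
    change (φ ^ (N + 1)) (e.symm p : V) = (φ ^ N) x
    rw [pow_succ, Module.End.mul_apply, hp, eq_comm, ← sub_eq_zero, ← map_sub]
    exact hx

namespace DGModule

variable {k : Type uk} [CommRing k] {A : Type u} [Ring A] [Algebra k A]
  {𝒜 : ℤ → Submodule k A} [GradedAlgebra 𝒜] {D : DGAlgebra 𝒜}

/-- The kernels and images of the powers of an endomorphism of an induced dg module become
stationary. -/
theorem IsInduced.exists_stable {M : DGModule.{uk, u, w} D} {m : ℤ} (hM : M.IsInduced m)
    (f : Hom M M) : ∃ N : ℕ, ∀ (i : ℤ) (x : M.X i),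
      ((f ^ (N + 1)).toFun i x = 0 → (f ^ N).toFun i x = 0) ∧
      ∃ y, (f ^ N).toFun i x = (f ^ (N + 1)).toFun i y := by
  have := hM.noetherian
  have := hM.artinian
  obtain ⟨N, γ, h₁, h₂⟩ := Module.End.exists_mul_pow_succ_eq (f.component m)
  rw [f.component_pow, f.component_pow] at h₁ h₂
  refine ⟨N, fun i x => ?_⟩
  have hi : m + (i - m) = i := by omega
  obtain ⟨t, rfl⟩ := hM.surj hi x
  constructor
  · intro hx
    rw [Hom.apply_mulMap] at hx ⊢
    -- Applying `γ ⊗ id` turns the relation `φ^(N+1) t` into `φ^N t`, which is thus again a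
    -- relation. `N` was chosen in degree `m` alone, so it serves every `i`.
    have := map_tensorRel_le γ (hM.inj _ _ hx)
    rw [tensorMap_comp] at this
    rw [← h₁]
    exact M.mulMap_eq_zero_of_mem_tensorRel _ this
  · refine ⟨M.mulMap hi (tensorMap γ _ t), ?_⟩
    rw [Hom.apply_mulMap, Hom.apply_mulMap, tensorMap_comp]
    exact congrArg (fun φ => M.mulMap hi (tensorMap φ _ t)) h₂.symm

/-! ### Subquotients and their induced morphisms. -/

section Subquotient

variable {M : DGModule.{uk, u, w} D}

/-- The class of an element of `V` in the subquotient `V / U`. -/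
def Sub.mkQ (U V : Sub M) (i : ℤ) : V.carrier i →+ (U.subquotient V).X i :=
  QuotientAddGroup.mk' ((U.carrier i).addSubgroupOf (V.carrier i))

theorem Sub.mkQ_surjective (U V : Sub M) (i : ℤ) : Function.Surjective (U.mkQ V i) :=
  QuotientAddGroup.mk'_surjective _

theorem Sub.mkQ_eq_zero_iff (U V : Sub M) {i : ℤ} (x : V.carrier i) :
    U.mkQ V i x = 0 ↔ x.1 ∈ U.carrier i :=
  (QuotientAddGroup.eq_zero_iff x).trans AddSubgroup.mem_addSubgroupOf

/-- The morphism `V / U → V' / U'` induced by an endomorphism mapping `U` to `U'` and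
`V` to `V'`. -/
def Hom.subquotientMap (f : Hom M M) {U V U' V' : Sub M}
    (hU : ∀ i, ∀ x ∈ U.carrier i, f.toFun i x ∈ U'.carrier i)
    (hV : ∀ i, ∀ x ∈ V.carrier i, f.toFun i x ∈ V'.carrier i) :
    Hom (U.subquotient V) (U'.subquotient V') where
  toFun i := QuotientAddGroup.map _ _
    (((f.toFun i).comp (V.carrier i).subtype).codRestrict (V'.carrier i) fun x => hV i x.1 x.2)
    (fun x hx => hU i x.1 hx)
  map_act h x a := by
    obtain ⟨x, rfl⟩ := U.mkQ_surjective V _ x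
    exact congrArg (U'.mkQ V' _) (Subtype.ext (f.map_act h x.1 a))
  map_d h x := by
    obtain ⟨x, rfl⟩ := U.mkQ_surjective V _ x
    exact congrArg (U'.mkQ V' _) (Subtype.ext (f.map_d h x.1))

theorem Hom.subquotientMap_mkQ (f : Hom M M) {U V U' V' : Sub M}
    (hU : ∀ i, ∀ x ∈ U.carrier i, f.toFun i x ∈ U'.carrier i)
    (hV : ∀ i, ∀ x ∈ V.carrier i, f.toFun i x ∈ V'.carrier i) {i : ℤ} (x : V.carrier i) :
    (f.subquotientMap hU hV).toFun i (U.mkQ V i x) = U'.mkQ V' i ⟨f.toFun i x.1, hV i x.1 x.2⟩ :=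
  rfl

theorem Hom.subquotientMap_pow_mkQ (f : Hom M M) {U V : Sub M}
    (hU : ∀ i, ∀ x ∈ U.carrier i, f.toFun i x ∈ U.carrier i)
    (hV : ∀ i, ∀ x ∈ V.carrier i, f.toFun i x ∈ V.carrier i) (n : ℕ) {i : ℤ}
    (x : V.carrier i) :
    ((f.subquotientMap hU hV) ^ n).toFun i (U.mkQ V i x) =
      U.mkQ V i ⟨(f ^ n).toFun i x.1, f.apply_mem_of_pow hV n i x.1 x.2⟩ := by
  induction n generalizing x with
  | zero => rfl
  | succ n ih =>
    rw [Hom.pow_succ_apply, Hom.subquotientMap_mkQ, ih]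
    simp only [Hom.pow_succ_apply]

/-- Extension closure applied to `0 → V/U → V'/U → V'/V → 0`, both maps being induced by the
identity of `M`. -/
theorem Sub.isInduced_subquotient_trans {U V V' : Sub M} (h : U ≤ V) (h' : V ≤ V') {m : ℤ}
    (hUV : (U.subquotient V).IsInduced m) (hVV' : (V.subquotient V').IsInduced m) :
    (U.subquotient V').IsInduced m := by
  have hid : ∀ {W W' : Sub M}, W ≤ W' → ∀ i, ∀ x ∈ W.carrier i,
      (Hom.id M).toFun i x ∈ W'.carrier i := fun hW i _ hx => hW i hx
  refine hUV.of_exact hVV' ((Hom.id M).subquotientMap (hid le_rfl) (hid h'))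
    ((Hom.id M).subquotientMap (hid h) (hid le_rfl)) (fun i => ?_) (fun i x => ?_) (fun i x => ?_)
  · rw [injective_iff_map_eq_zero]
    intro x hx
    obtain ⟨x, rfl⟩ := U.mkQ_surjective V i x
    rw [Hom.subquotientMap_mkQ, Sub.mkQ_eq_zero_iff] at hx
    exact (U.mkQ_eq_zero_iff V x).2 hx
  · obtain ⟨x, rfl⟩ := V.mkQ_surjective V' i x
    exact ⟨U.mkQ V' i x, rfl⟩
  · obtain ⟨x, rfl⟩ := U.mkQ_surjective V' i x
    constructor
    · intro hx
      rw [Hom.subquotientMap_mkQ, Sub.mkQ_eq_zero_iff] at hx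
      exact ⟨U.mkQ V i ⟨x.1, hx⟩, rfl⟩
    · rintro ⟨y, hy⟩
      obtain ⟨y, rfl⟩ := U.mkQ_surjective V i y
      rw [Hom.subquotientMap_mkQ, ← sub_eq_zero, ← map_sub, Sub.mkQ_eq_zero_iff] at hy
      rw [Hom.subquotientMap_mkQ, Sub.mkQ_eq_zero_iff]
      have := V.carrier i |>.sub_mem y.2 (h i hy)
      simpa [Hom.id] using this

/-- If `V / U` is induced from degree `m`, then `U` and `V` agree in degrees less than `m`. -/
theorem IsInduced.mem_of_lt (hD : D.IsAdmissible) {U V : Sub M} {m : ℤ}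
    (h : (U.subquotient V).IsInduced m) {i : ℤ} (hi : i < m) {x : M.X i}
    (hx : x ∈ V.carrier i) : x ∈ U.carrier i :=
  (U.mkQ_eq_zero_iff V ⟨x, hx⟩).1 (h.eq_zero hD hi _)

/-- If `V / U` is induced from degree `m`, then `V` is generated by `U` and `V^m`. -/
theorem IsInduced.apply_mem {U V T : Sub M} {m : ℤ} (h : (U.subquotient V).IsInduced m)
    (f : Hom M M) (hU : ∀ i, ∀ x ∈ U.carrier i, f.toFun i x ∈ T.carrier i)
    (hV : ∀ x ∈ V.carrier m, f.toFun m x ∈ T.carrier m) (i : ℤ) :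
    ∀ x ∈ V.carrier i, f.toFun i x ∈ T.carrier i := by
  intro x hx
  have hi : m + (i - m) = i := by omega
  -- Each tensor has a representative of its product in `V` that `f` sends into `T`. For the class
  -- of `x` such a representative differs from `x` by an element of `U`, where `hU` applies.
  have key : ∀ t, ∃ z : V.carrier i,
      U.mkQ V i z = (U.subquotient V).mulMap hi t ∧ f.toFun i z.1 ∈ T.carrier i := by
    intro t
    induction t with
    | zero => exact ⟨0, by simp, by simp⟩
    | tmul y a =>
      obtain ⟨y, rfl⟩ := U.mkQ_surjective V m y
      refine ⟨⟨M.act hi y.1 a, V.act_mem hi a y.2⟩, rfl, ?_⟩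
      rw [f.map_act]
      exact T.act_mem hi a (hV y.1 y.2)
    | add s t hs ht =>
      obtain ⟨y, hy, hy'⟩ := hs
      obtain ⟨z, hz, hz'⟩ := ht
      refine ⟨y + z, by rw [map_add, map_add, hy, hz], ?_⟩
      rw [AddSubgroup.coe_add, map_add]
      exact add_mem hy' hz'
  obtain ⟨t, ht⟩ := h.surj hi (U.mkQ V i ⟨x, hx⟩)
  obtain ⟨z, hz, hz'⟩ := key t
  rw [ht, eq_comm, ← sub_eq_zero, ← map_sub, Sub.mkQ_eq_zero_iff] at hz
  have := add_mem (hU i _ hz) hz'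
  rwa [← map_add, AddSubgroup.coe_sub, sub_add_cancel] at this

end Subquotient

/-! ### Stationarity, gluing and the Fitting decomposition. -/

section Fitting

variable {M : DGModule.{uk, u, w} D}

/-- The kernels and images of the powers of the endomorphism of `V / U` induced by `f` are
stationary from the exponent `N` on. -/
def Hom.IsStable (f : Hom M M) (U V : Sub M) (N : ℕ) : Prop :=
  ∀ i, ∀ x ∈ V.carrier i,
    ((f ^ (N + 1)).toFun i x ∈ U.carrier i → (f ^ N).toFun i x ∈ U.carrier i) ∧
    ∃ y ∈ V.carrier i, (f ^ N).toFun i x - (f ^ (N + 1)).toFun i y ∈ U.carrier i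

theorem IsInduced.exists_isStable {U V : Sub M} {m : ℤ} (h : (U.subquotient V).IsInduced m)
    (f : Hom M M) (hU : ∀ i, ∀ x ∈ U.carrier i, f.toFun i x ∈ U.carrier i)
    (hV : ∀ i, ∀ x ∈ V.carrier i, f.toFun i x ∈ V.carrier i) : ∃ N, f.IsStable U V N := by
  obtain ⟨N, hN⟩ := h.exists_stable (f.subquotientMap hU hV)
  refine ⟨N, fun i x hx => ?_⟩
  obtain ⟨h₁, y, hy⟩ := hN i (U.mkQ V i ⟨x, hx⟩)
  obtain ⟨y, rfl⟩ := U.mkQ_surjective V i y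
  simp only [Hom.subquotientMap_pow_mkQ, Sub.mkQ_eq_zero_iff] at h₁
  refine ⟨h₁, y.1, y.2, ?_⟩
  rwa [Hom.subquotientMap_pow_mkQ, Hom.subquotientMap_pow_mkQ, ← sub_eq_zero, ← map_sub,
    Sub.mkQ_eq_zero_iff] at hy

theorem Hom.IsStable.mem_of_pow_mem {f : Hom M M} {U V : Sub M} {N : ℕ}
    (h : f.IsStable U V N) (hV : ∀ i, ∀ x ∈ V.carrier i, f.toFun i x ∈ V.carrier i)
    (n : ℕ) {i : ℤ} {x : M.X i} (hx : x ∈ V.carrier i)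
    (hn : (f ^ (N + n)).toFun i x ∈ U.carrier i) : (f ^ N).toFun i x ∈ U.carrier i := by
  induction n generalizing x with
  | zero => exact hn
  | succ n ih =>
    refine (h i x hx).1 ?_
    rw [Hom.pow_succ_apply]
    refine ih (hV i x hx) ?_
    rwa [← Hom.pow_succ_apply]

/-- The one-step approximation is iterated by pushing its error forward with `f ^ n`; invariance of
`U` keeps the error in `U`. -/
theorem Hom.IsStable.exists_sub_mem {f : Hom M M} {U V : Sub M} {N : ℕ}
    (h : f.IsStable U V N) (hU : ∀ i, ∀ x ∈ U.carrier i, f.toFun i x ∈ U.carrier i)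
    (n : ℕ) {i : ℤ} {x : M.X i} (hx : x ∈ V.carrier i) :
    ∃ y ∈ V.carrier i, (f ^ N).toFun i x - (f ^ (N + n)).toFun i y ∈ U.carrier i := by
  induction n with
  | zero => exact ⟨x, hx, by simp⟩
  | succ n ih =>
    obtain ⟨y, hy, hxy⟩ := ih
    obtain ⟨z, hz, hyz⟩ := (h i y hy).2
    refine ⟨z, hz, ?_⟩
    have := add_mem hxy (f.apply_mem_of_pow hU n i _ hyz)
    rwa [map_sub, ← Hom.pow_add_apply, ← Hom.pow_add_apply, add_comm n N, sub_add_sub_cancel,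
      show n + (N + 1) = N + (n + 1) by omega] at this

/-- For kernels, `f^(N')` first brings `x` into `V`, where exponent `N` finishes. For images,
`f^(N') x` is first approximated modulo `V`, and `f^N` of the error is then approximated modulo `U`.
-/
theorem Hom.IsStable.trans {f : Hom M M} {U V V' : Sub M} {N N' : ℕ} (hVV' : V ≤ V')
    (hU : ∀ i, ∀ x ∈ U.carrier i, f.toFun i x ∈ U.carrier i)
    (hV' : ∀ i, ∀ x ∈ V'.carrier i, f.toFun i x ∈ V'.carrier i)
    (h : f.IsStable U V N) (h' : f.IsStable V V' N') (hUV : U ≤ V) :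
    f.IsStable U V' (N + N') := by
  intro i x hx
  constructor
  · intro hx'
    have h₁ : (f ^ N').toFun i x ∈ V.carrier i :=
      h'.mem_of_pow_mem hV' (N + 1) hx (by
        rw [show N' + (N + 1) = N + N' + 1 by omega]; exact hUV i hx')
    rw [Hom.pow_add_apply]
    refine (h i _ h₁).1 ?_
    rwa [← Hom.pow_add_apply, add_right_comm]
  · obtain ⟨y, hy, hxy⟩ := (h' i x hx).2
    -- The extra exponent `N' + 1` makes the correction an image under `f ^ (N + N' + 1)`, the same
    -- power that acts on `y`.
    obtain ⟨z, hz, hyz⟩ := h.exists_sub_mem hU (N' + 1) hxy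
    refine ⟨y + z, add_mem hy (hVV' i hz), ?_⟩
    rw [map_sub, ← Hom.pow_add_apply, ← Hom.pow_add_apply, sub_sub, ← add_assoc,
      ← map_add] at hyz
    exact hyz

theorem Hom.IsStable.fitting {f : Hom M M} {N : ℕ} (h : f.IsStable ⊥ ⊤ N) {n : ℕ}
    (hn : N ≤ n) : (f ^ n).ker = (f ^ (n + 1)).ker ∧ (f ^ n).im = (f ^ (n + 1)).im ∧
      Sub.IsDirectSum (f ^ n).ker (f ^ n).im := by
  have hker : ∀ (p : ℕ) {i : ℤ} {x : M.X i}, (f ^ (n + p)).toFun i x = 0 →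
      (f ^ n).toFun i x = 0 := by
    intro p i x hx
    obtain ⟨q, rfl⟩ := Nat.exists_eq_add_of_le hn
    have h₀ : (f ^ N).toFun i x = 0 :=
      h.mem_of_pow_mem (fun _ _ _ => AddSubgroup.mem_top _) (q + p) (AddSubgroup.mem_top _) (by
        rw [← add_assoc, hx]; exact zero_mem _)
    rw [add_comm N q, Hom.pow_add_apply, h₀, map_zero]
  have him : ∀ (p : ℕ) {i : ℤ} (x : M.X i), ∃ y,
      (f ^ n).toFun i x = (f ^ (n + p)).toFun i y := by
    intro p i x
    obtain ⟨q, rfl⟩ := Nat.exists_eq_add_of_le hn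
    obtain ⟨y, -, hy⟩ := h.exists_sub_mem (x := x) (fun i x hx => by
      rw [show x = 0 from hx, map_zero]; exact zero_mem _) p (AddSubgroup.mem_top _)
    refine ⟨y, ?_⟩
    have hy' : (f ^ N).toFun i x = (f ^ (N + p)).toFun i y := sub_eq_zero.1 hy
    rw [add_comm N q, Hom.pow_add_apply, hy', ← Hom.pow_add_apply, add_assoc]
  refine ⟨Sub.ext (funext fun i => ?_), Sub.ext (funext fun i => ?_), fun i => ?_⟩
  · ext x
    refine ⟨fun hx => ?_, fun hx => hker 1 hx⟩
    change (f ^ (n + 1)).toFun i x = 0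
    rw [add_comm, Hom.pow_add_apply, show (f ^ n).toFun i x = 0 from hx, map_zero]
  · ext x
    constructor
    · rintro ⟨y, rfl⟩
      obtain ⟨z, hz⟩ := him 1 y
      exact ⟨z, hz.symm⟩
    · rintro ⟨y, rfl⟩
      exact ⟨f.toFun i y, (f.pow_succ_apply n y).symm⟩
  -- Comparing `f^n` with `f^(2n)`: equal kernels make the intersection zero, equal images make the
  -- sum everything.
  · rw [isCompl_iff, disjoint_iff_inf_le, codisjoint_iff_le_sup]
    constructor
    · rintro _ ⟨hx, y, rfl⟩
      refine hker n ?_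
      rw [Hom.pow_add_apply]
      exact hx
    · intro x _
      obtain ⟨y, hy⟩ := him n x
      refine AddSubgroup.mem_sup.2 ⟨x - (f ^ n).toFun i y, ?_, (f ^ n).toFun i y, ⟨y, rfl⟩,
        sub_add_cancel _ _⟩
      change (f ^ n).toFun i _ = 0
      rw [map_sub, ← Hom.pow_add_apply, hy, sub_self]

/-! ### Blocks of constant degree in the filtration. -/

/-- If `M` has a finite filtration whose successive subquotients are induced from weakly
increasing degrees, then the kernels and images of the powers of every endomorphism of `M` become
stationary. The endomorphism need not respect the filtration itself, only those steps at which
the degree jumps. -/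
theorem exists_isStable_of_filtration (hD : D.IsAdmissible) (f : Hom M M) {n : ℕ}
    {F : ℕ → Sub M} {m : ℕ → ℤ} (h₀ : F 0 = ⊥) (hn : F n = ⊤) (hF : Monotone F)
    (hm : ∀ i j, i ≤ j → j < n → m i ≤ m j)
    (hind : ∀ i < n, ((F i).subquotient (F (i + 1))).IsInduced (m i)) :
    ∃ N, f.IsStable ⊥ ⊤ N := by
  -- No later factor has elements in a degree below all later `m j`, so descending from `F n = ⊤`
  -- loses nothing there.
  have hagree : ∀ i ≤ n, ∀ d, (∀ j, i ≤ j → j < n → d < m j) →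
      ∀ x : M.X d, x ∈ (F i).carrier d := by
    intro i hi
    induction hi using Nat.decreasingInduction with
    | self => intro d _ x; rw [hn]; exact AddSubgroup.mem_top x
    | of_succ i hi ih =>
      intro d hd x
      exact (hind i hi).mem_of_lt hD (hd i le_rfl hi)
        (ih d (fun j hj hjn => hd j (by omega) hjn) x)
  have hbot : ∀ i, ∀ x ∈ (⊥ : Sub M).carrier i, f.toFun i x ∈ (⊥ : Sub M).carrier i := by
    intro i x hx
    rw [show x = 0 from hx, map_zero]
    exact zero_mem _
  have hcut : ∀ i ≤ n, (∀ p < i, ∀ j, i ≤ j → j < n → m p < m j) →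
      ∀ d, ∀ x ∈ (F i).carrier d, f.toFun d x ∈ (F i).carrier d := by
    intro i hi hlt
    -- The target stays `F i` while the source `F p` grows, since an intermediate `F p` may fail to
    -- be invariant.
    have : ∀ p ≤ i, ∀ d, ∀ x ∈ (F p).carrier d, f.toFun d x ∈ (F i).carrier d := by
      intro p
      induction p with
      | zero => intro _ d x hx; rw [h₀] at hx; exact bot_le (a := F i) d (hbot d x hx)
      | succ p ih =>
        intro hp
        exact (hind p (by omega)).apply_mem f (ih (by omega))
          (fun x _ => hagree i hi _ (hlt p (by omega)) _)
    exact this i le_rfl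
  -- `F j` is the start of the block containing step `i`. At equal degrees the block is extended; at
  -- a jump it is closed and a new one starts at `i + 1`.
  have main : ∀ i < n, ∃ j ≤ i, m j = m i ∧
      (∀ d, ∀ x ∈ (F j).carrier d, f.toFun d x ∈ (F j).carrier d) ∧
      (∃ N, f.IsStable ⊥ (F j) N) ∧
      ((F j).subquotient (F (i + 1))).IsInduced (m i) := by
    intro i
    induction i with
    | zero =>
      intro hi
      refine ⟨0, le_rfl, rfl, by rw [h₀]; exact hbot, ⟨0, ?_⟩, hind 0 hi⟩
      rw [h₀]
      exact fun d x hx => ⟨fun _ => hx, x, hx, sub_mem hx (hbot d x hx)⟩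
    | succ i ih =>
      intro hi
      obtain ⟨j, hj, hmj, hstab, ⟨N, hN⟩, hI⟩ := ih (by omega)
      rcases (hm i (i + 1) (by omega) hi).eq_or_lt with heq | hlt
      · refine ⟨j, by omega, hmj.trans heq, hstab, ⟨N, hN⟩, ?_⟩
        exact Sub.isInduced_subquotient_trans (hF (by omega)) (hF (by omega)) (heq ▸ hI)
          (hind (i + 1) hi)
      · have hstab' := hcut (i + 1) (by omega) (fun p hp q hq hqn =>
          (hm p i (by omega) (by omega)).trans_lt (hlt.trans_le (hm _ _ hq hqn)))
        obtain ⟨N', hN'⟩ := hI.exists_isStable f hstab hstab'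
        exact ⟨i + 1, le_rfl, rfl, hstab', ⟨N + N', hN.trans (hF (by omega)) hbot hstab'
          hN' bot_le⟩, hind (i + 1) hi⟩
  have htop : ∀ i, ∀ x ∈ (⊤ : Sub M).carrier i, f.toFun i x ∈ (⊤ : Sub M).carrier i :=
    fun _ _ _ => AddSubgroup.mem_top _
  obtain _ | n := n
  · refine ⟨0, ?_⟩
    rw [← hn, h₀]
    exact fun d x hx => ⟨fun _ => hx, x, hx, sub_mem hx (hbot d x hx)⟩
  -- The last block is still open; it ends at `⊤`, which is trivially invariant.
  · obtain ⟨j, -, -, hstab, ⟨N, hN⟩, hI⟩ := main n n.lt_succ_self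
    rw [hn] at hI
    obtain ⟨N', hN'⟩ := hI.exists_isStable f hstab htop
    exact ⟨N + N', hN.trans le_top hbot htop hN' bot_le⟩

theorem IsFilt.exists_isStable (hD : D.IsAdmissible) (hM : IsFilt hD M) (f : Hom M M) :
    ∃ N, f.IsStable ⊥ ⊤ N := by
  obtain ⟨n, F, l, h₀, hn, hF, hl, hiso⟩ := hM
  refine exists_isStable_of_filtration hD f (n := n)
    -- Clamping at `n` keeps the extended filtration monotone; the default degree `0` is never used,
    -- because degrees matter only for indices below `n`.
    (F := fun i => F ⟨min i n, by omega⟩)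
    (m := fun i => if h : i < n then -l ⟨i, h⟩ else 0) ?_ ?_ ?_ ?_ ?_
  · rw [← h₀]
    exact congrArg F (Fin.ext (by simp))
  · rw [← hn]
    exact congrArg F (Fin.ext (by simp))
  · intro i j hij
    exact hF (Fin.mk_le_mk.2 (min_le_min_right n hij))
  · intro i j hij hj
    rw [dif_pos hj, dif_pos (hij.trans_lt hj)]
    exact neg_le_neg (hl (Fin.mk_le_mk.2 hij))
  · intro i hi
    rw [dif_pos hi]
    obtain ⟨L, _, _, hL, ⟨e⟩⟩ := hiso ⟨i, hi⟩
    have h₁ : (⟨min i n, by omega⟩ : Fin (n + 1)) = Fin.castSucc ⟨i, hi⟩ :=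
      Fin.ext (min_eq_left hi.le)
    have h₂ : (⟨min (i + 1) n, by omega⟩ : Fin (n + 1)) = Fin.succ ⟨i, hi⟩ :=
      Fin.ext (min_eq_left hi)
    simp only [h₁, h₂]
    exact (isInduced_shift_hat hD.d_zero _).of_iso e

end Fitting

end DGModule

theorem proposition8p5 {k : Type uk} [CommRing k] {A : Type u} [Ring A] [Algebra k A]
    {𝒜 : ℤ → Submodule k A} [GradedAlgebra 𝒜] (D : DGAlgebra 𝒜) (hD : D.IsAdmissible)
    (M : DGModule.{uk, u, w} D) (hM : DGModule.IsFilt hD M) (f : DGModule.Hom M M) :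
    ∃ N : ℕ, ∀ n : ℕ, N ≤ n →
      (f ^ n).ker = (f ^ (n + 1)).ker ∧
      (f ^ n).im = (f ^ (n + 1)).im ∧
      DGModule.Sub.IsDirectSum (f ^ n).ker (f ^ n).im := by
  obtain ⟨N, hN⟩ := hM.exists_isStable hD f
  exact ⟨N, fun n hn => hN.fitting hn⟩
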